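/- Theorem (advantage in discounted safety value). Consider a control-affine system $\dot x=f(x)+g(x)u$ with state space $\mathcal X\subseteq\mathbb R^n$ and nonempty bounded input space $\mathcal U=\{u\in\mathbb R^m : Au\le b\}$, where $f:\mathcal X\to\mathbb R^n$ and $g:\mathcal X\to\mathbb R^{n\times m}$ are continuous. The set $\mathcal X$ may be any subset of $\mathbb R^n$ on which derivatives are unique (at each of its points the tangent directions of $\mathcal X$ span $\mathbb R^n$; for instance $\mathcal X$ open), and derivatives at points of $\mathcal X$ are taken relative to $\mathcal X$. An admissible control is a measurable function $\pi:[0,\infty)\to\mathcal U$. Assume that for every $x\in\mathcal X$ and every admissible control $\pi$ there is exactly one trajectory $x^\pi:[0,\infty)\to\mathcal X$ with $x^\pi_t=x+\int_0^t \big(f(x^\pi_\tau)+g(x^\pi_\tau)\pi(\tau)\big)\,d\tau$ for all $t\ge 0$; for $u\in\mathcal U$ write $x^u$ for the trajectory of the constant control $u$. Let $c:\mathcal X\to\mathbb R$ be differentiable and let $\lambda\ge 0$. Define $$V^\lambda(x)=\sup_\pi\inf_{t\ge 0}\Big\{\int_0^t\lambda e^{-\lambda\tau}c(x^\pi_\tau)\,d\tau+e^{-\lambda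 t}c(x^\pi_t)\Big\},$$ the supremum being over all admissible controls, and, for $s>0$ and $u\in\mathcal U$, $$Q^\lambda_s(x,u)=\min\Big\{\min_{0\le t\le s}\Big[\int_0^t\lambda e^{-\lambda\tau}c(x^u_\tau)\,d\tau+e^{-\lambda t}c(x^u_t)\Big],\ \int_0^s\lambda e^{-\lambda\tau}c(x^u_\tau)\,d\tau+e^{-\lambda s}V^\lambda(x^u_s)\Big\}.$$ Assume that $V^\lambda$ is finite and differentiable on $\mathcal X$. Then for all $x\in\mathcal X$ and $u\in\mathcal U$ the limit $$q^\lambda(x,u)=\lim_{s\downarrow 0}\frac{Q^\lambda_s(x,u)-V^\lambda(x)}{s}$$ exists in $\mathbb R$ and $$q^\lambda(x,u)=\min\Big\{c(x)-V^\lambda(x),\ \frac{\partial V^\lambda}{\partial x}(x)\big(f(x)+g(x)u\big)+\lambda\big(c(x)-V^\lambda(x)\big)\Big\}.$$ Moreover $q^\lambda(x,u)\le 0$ for all $(x,u)\in\mathcal X\times\mathcal U$, and $\max_{u\in\mathcal U}q^\lambda(x,u)=0$ for every $x\in\mathcal X$ (the maximum is attained). -/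

import Mathlib

open MeasureTheory Set Filter Topology
open scoped Matrix

noncomputable section

namespace SafetyAdvantage

/-- The polyhedral input space `{u ∈ ℝᵐ | A u ≤ b}` (componentwise inequality). -/
def inputSpace {m k : ℕ} (A : Matrix (Fin k) (Fin m) ℝ) (b : Fin k → ℝ) :
    Set (EuclideanSpace ℝ (Fin m)) :=
  {u | ∀ i, (A *ᵥ u.ofLp) i ≤ b i}

/-- Admissible controls: measurable signals with values in `U` at all times `t ≥ 0`. -/
def IsControl {m : ℕ} (U : Set (EuclideanSpace ℝ (Fin m)))
    (w : ℝ → EuclideanSpace ℝ (Fin m)) : Prop :=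
  Measurable w ∧ ∀ t, 0 ≤ t → w t ∈ U

/-- `ξ` is a (Carathéodory, i.e. absolutely continuous) solution on `[0, ∞)`, with values in the
state space `X`, of `ẋ = f(x) + g(x) w(t)`, `x(0) = x`. -/
def IsTrajectory {n m : ℕ} (X : Set (EuclideanSpace ℝ (Fin n)))
    (f : EuclideanSpace ℝ (Fin n) → EuclideanSpace ℝ (Fin n))
    (g : EuclideanSpace ℝ (Fin n) → (EuclideanSpace ℝ (Fin m) →L[ℝ] EuclideanSpace ℝ (Fin n)))
    (x : EuclideanSpace ℝ (Fin n)) (w : ℝ → EuclideanSpace ℝ (Fin m))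
    (ξ : ℝ → EuclideanSpace ℝ (Fin n)) : Prop :=
  ∀ t, 0 ≤ t → ξ t ∈ X ∧
    IntervalIntegrable (fun τ => f (ξ τ) + g (ξ τ) (w τ)) volume 0 t ∧
    ξ t = x + ∫ τ in (0 : ℝ)..t, (f (ξ τ) + g (ξ τ) (w τ))

/-- Well-posedness: from every state in `X`, every admissible control drives exactly one
trajectory, which exists for all times `t ≥ 0` and stays in `X`. -/
def WellPosed {n m : ℕ} (X : Set (EuclideanSpace ℝ (Fin n)))
    (U : Set (EuclideanSpace ℝ (Fin m)))
    (f : EuclideanSpace ℝ (Fin n) → EuclideanSpace ℝ (Fin n))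
    (g : EuclideanSpace ℝ (Fin n) → (EuclideanSpace ℝ (Fin m) →L[ℝ] EuclideanSpace ℝ (Fin n))) :
    Prop :=
  ∀ x ∈ X, ∀ w, IsControl U w →
    ∃ ξ, IsTrajectory X f g x w ξ ∧
      ∀ η, IsTrajectory X f g x w η → EqOn η ξ (Ici 0)

open Classical in
/-- `state X f g x w t` is the state at time `t` driven by the control `w` from the state `x`
(a placeholder value is used if there is no trajectory). -/
def state {n m : ℕ} (X : Set (EuclideanSpace ℝ (Fin n)))
    (f : EuclideanSpace ℝ (Fin n) → EuclideanSpace ℝ (Fin n))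
    (g : EuclideanSpace ℝ (Fin n) → (EuclideanSpace ℝ (Fin m) →L[ℝ] EuclideanSpace ℝ (Fin n)))
    (x : EuclideanSpace ℝ (Fin n)) (w : ℝ → EuclideanSpace ℝ (Fin m)) :
    ℝ → EuclideanSpace ℝ (Fin n) :=
  if h : ∃ ξ, IsTrajectory X f g x w ξ then h.choose else fun _ => x

/-- `∫₀ᵗ λ e^{-λτ} c(ξ(τ)) dτ`. -/
def runningTerm {n : ℕ} (lam : ℝ) (c : EuclideanSpace ℝ (Fin n) → ℝ)
    (ξ : ℝ → EuclideanSpace ℝ (Fin n)) (t : ℝ) : ℝ :=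
  ∫ τ in (0 : ℝ)..t, lam * Real.exp (-lam * τ) * c (ξ τ)

/-- `∫₀ᵗ λ e^{-λτ} c(ξ(τ)) dτ + e^{-λt} c(ξ(t))`. -/
def discountedOutput {n : ℕ} (lam : ℝ) (c : EuclideanSpace ℝ (Fin n) → ℝ)
    (ξ : ℝ → EuclideanSpace ℝ (Fin n)) (t : ℝ) : ℝ :=
  runningTerm lam c ξ t + Real.exp (-lam * t) * c (ξ t)

/-- The discounted safety value `V^λ(x)` as an extended real: the supremum over all admissible
controls of the infimum over all times `t ≥ 0` of the discounted output. -/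
def extValue {n m : ℕ} (X : Set (EuclideanSpace ℝ (Fin n)))
    (U : Set (EuclideanSpace ℝ (Fin m)))
    (f : EuclideanSpace ℝ (Fin n) → EuclideanSpace ℝ (Fin n))
    (g : EuclideanSpace ℝ (Fin n) → (EuclideanSpace ℝ (Fin m) →L[ℝ] EuclideanSpace ℝ (Fin n)))
    (c : EuclideanSpace ℝ (Fin n) → ℝ) (lam : ℝ) (x : EuclideanSpace ℝ (Fin n)) : EReal :=
  ⨆ (w : ℝ → EuclideanSpace ℝ (Fin m)) (_ : IsControl U w),
    ⨅ (t : ℝ) (_ : 0 ≤ t), ((discountedOutput lam c (state X f g x w) t : ℝ) : EReal)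

/-- The discounted safety value `V^λ(x)` as a real number (meaningful where it is finite). -/
def value {n m : ℕ} (X : Set (EuclideanSpace ℝ (Fin n)))
    (U : Set (EuclideanSpace ℝ (Fin m)))
    (f : EuclideanSpace ℝ (Fin n) → EuclideanSpace ℝ (Fin n))
    (g : EuclideanSpace ℝ (Fin n) → (EuclideanSpace ℝ (Fin m) →L[ℝ] EuclideanSpace ℝ (Fin n)))
    (c : EuclideanSpace ℝ (Fin n) → ℝ) (lam : ℝ) (x : EuclideanSpace ℝ (Fin n)) : ℝ :=
  (extValue X U f g c lam x).toReal

/-- The discounted state-action safety value `Q^λ_s(x,u)`: the constant input `u` is applied on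
`[0, s]`. For continuous outputs the infimum over `[0, s]` is a minimum. -/
def stateActionValue {n m : ℕ} (X : Set (EuclideanSpace ℝ (Fin n)))
    (U : Set (EuclideanSpace ℝ (Fin m)))
    (f : EuclideanSpace ℝ (Fin n) → EuclideanSpace ℝ (Fin n))
    (g : EuclideanSpace ℝ (Fin n) → (EuclideanSpace ℝ (Fin m) →L[ℝ] EuclideanSpace ℝ (Fin n)))
    (c : EuclideanSpace ℝ (Fin n) → ℝ) (lam s : ℝ)
    (x : EuclideanSpace ℝ (Fin n)) (u : EuclideanSpace ℝ (Fin m)) : ℝ :=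
  min (sInf (discountedOutput lam c (state X f g x (fun _ => u)) '' Icc 0 s))
    (runningTerm lam c (state X f g x (fun _ => u)) s +
      Real.exp (-lam * s) * value X U f g c lam (state X f g x (fun _ => u) s))

/-- The difference quotient `(Q^λ_s(x,u) - V^λ(x)) / s`. -/
def advantageQuotient {n m : ℕ} (X : Set (EuclideanSpace ℝ (Fin n)))
    (U : Set (EuclideanSpace ℝ (Fin m)))
    (f : EuclideanSpace ℝ (Fin n) → EuclideanSpace ℝ (Fin n))
    (g : EuclideanSpace ℝ (Fin n) → (EuclideanSpace ℝ (Fin m) →L[ℝ] EuclideanSpace ℝ (Fin n)))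
    (c : EuclideanSpace ℝ (Fin n) → ℝ) (lam : ℝ)
    (x : EuclideanSpace ℝ (Fin n)) (u : EuclideanSpace ℝ (Fin m)) (s : ℝ) : ℝ :=
  (stateActionValue X U f g c lam s x u - value X U f g c lam x) / s

/-- The advantage `q^λ(x,u) = lim_{s ↓ 0} (Q^λ_s(x,u) - V^λ(x)) / s`. -/
def advantage {n m : ℕ} (X : Set (EuclideanSpace ℝ (Fin n)))
    (U : Set (EuclideanSpace ℝ (Fin m)))
    (f : EuclideanSpace ℝ (Fin n) → EuclideanSpace ℝ (Fin n))
    (g : EuclideanSpace ℝ (Fin n) → (EuclideanSpace ℝ (Fin m) →L[ℝ] EuclideanSpace ℝ (Fin n)))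
    (c : EuclideanSpace ℝ (Fin n) → ℝ) (lam : ℝ)
    (x : EuclideanSpace ℝ (Fin n)) (u : EuclideanSpace ℝ (Fin m)) : ℝ :=
  limUnder (𝓝[>] (0 : ℝ)) (advantageQuotient X U f g c lam x u)

end SafetyAdvantage

end

namespace SafetyAdvantage

section

variable {n m : ℕ} {X : Set (EuclideanSpace ℝ (Fin n))} {U : Set (EuclideanSpace ℝ (Fin m))}
  {f : EuclideanSpace ℝ (Fin n) → EuclideanSpace ℝ (Fin n)}
  {g : EuclideanSpace ℝ (Fin n) → (EuclideanSpace ℝ (Fin m) →L[ℝ] EuclideanSpace ℝ (Fin n))}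
  {x : EuclideanSpace ℝ (Fin n)} {w w₁ w₂ : ℝ → EuclideanSpace ℝ (Fin m)}
  {ξ ζ : ℝ → EuclideanSpace ℝ (Fin n)} {c : EuclideanSpace ℝ (Fin n) → ℝ} {lam : ℝ}

/-! ### Trajectories -/

/-! Fix `x` and `u`. Let `D` be the discounted output along the trajectory of the constant control
`u`, and let `B` be the running term plus the discounted value at the current state. Then `Q_s` is
the minimum of `inf D` over `[0, s]` and of `B s`, with `D 0 = c x` and `B 0 = V x`, and the right
derivative of `B` at `0` is the second argument of the claimed minimum.

Always `V ≤ c`, by taking time `0` in the infimum. If `V x < c x`, continuity makes `B` the smaller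
term for small `s`, so the limit is `B' 0`. If `V x = c x`, the running minimum of `D` contributes
`min 0 (D' 0)`. Since `V ≤ c` with equality at `x`, the derivative of `V` along the trajectory is at
most that of `c`, so `D' 0` drops out.

The dynamic programming principle gives the signs. Concatenating `u` with a nearly optimal control
shows `Q_s ≤ V` (`WellPosed.le_value_of_forall_le`), hence `q ≤ 0` and, when `V x < c x`, `B' 0 ≤
0`. Conversely, the tail of a nearly optimal control bounds `V x` from above
(`WellPosed.le_of_forall_le_discountedOutput`). The nearly optimal control varies with `s`, so the
passage `s ↓ 0` needs estimates uniform over all controls, which the boundedness of `U` supplies.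
They yield `WellPosed.le_of_forall_fderivWithin_le`, so an input maximizing the derivative of `V`
over the compact set `U` has advantage `0`. -/

theorem IsTrajectory.mem (h : IsTrajectory X f g x w ξ) {t : ℝ} (ht : 0 ≤ t) : ξ t ∈ X :=
  (h t ht).1

theorem IsTrajectory.apply_zero (h : IsTrajectory X f g x w ξ) : ξ 0 = x := by
  simpa using (h 0 le_rfl).2.2

theorem Icc_zero_mem_nhdsWithin_Ici {t : ℝ} :
    Icc 0 (t + 1) ∈ 𝓝[Ici 0] t := by
  rw [← Ici_inter_Iic]
  exact inter_mem self_mem_nhdsWithin (mem_nhdsWithin_of_mem_nhds (Iic_mem_nhds (by linarith)))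

theorem IsTrajectory.continuousOn (h : IsTrajectory X f g x w ξ) : ContinuousOn ξ (Ici 0) := by
  intro t ht
  have ht : 0 ≤ t := ht
  have h1 := intervalIntegral.continuousOn_primitive_interval'
    (h (t + 1) (by linarith)).2.1 left_mem_uIcc
  rw [uIcc_of_le (by linarith)] at h1
  have h2 : ContinuousOn ξ (Icc 0 (t + 1)) :=
    ((continuousOn_const (c := x)).add h1).congr fun s hs => (h s hs.1).2.2
  exact (h2 t ⟨ht, by linarith⟩).mono_of_mem_nhdsWithin Icc_zero_mem_nhdsWithin_Ici

/-- The tail of a trajectory is a trajectory of the shifted control. -/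
theorem IsTrajectory.shift (h : IsTrajectory X f g x w ξ) {s : ℝ} (hs : 0 ≤ s) :
    IsTrajectory X f g (ξ s) (fun t => w (s + t)) (fun t => ξ (s + t)) := by
  intro t ht
  have hst : 0 ≤ s + t := by linarith
  have hint : IntervalIntegrable (fun τ => f (ξ τ) + g (ξ τ) (w τ)) volume s (s + t) :=
    (h s hs).2.1.symm.trans (h (s + t) hst).2.1
  refine ⟨h.mem hst, ?_, ?_⟩
  · simpa using hint.comp_add_left s
  · have h1 := intervalIntegral.integral_comp_add_left (a := 0) (b := t)
      (fun τ => f (ξ τ) + g (ξ τ) (w τ)) s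
    simp only [add_zero] at h1
    simp only [h1]
    rw [(h (s + t) hst).2.2]
    nth_rewrite 1 [(h s hs).2.2]
    rw [add_assoc, intervalIntegral.integral_add_adjacent_intervals (h s hs).2.1 hint]

/-- Concatenation of two trajectories at time `s`. -/
theorem IsTrajectory.concat (h₁ : IsTrajectory X f g x w₁ ξ) {s : ℝ} (hs : 0 ≤ s)
    (h₂ : IsTrajectory X f g (ξ s) w₂ ζ) :
    IsTrajectory X f g x (fun t => if t ≤ s then w₁ t else w₂ (t - s))
      (fun t => if t ≤ s then ξ t else ζ (t - s)) := by
  set F : ℝ → EuclideanSpace ℝ (Fin n) := fun τ =>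
    f (if τ ≤ s then ξ τ else ζ (τ - s)) +
      g (if τ ≤ s then ξ τ else ζ (τ - s)) (if τ ≤ s then w₁ τ else w₂ (τ - s)) with hF
  have hF₁ : ∀ t, 0 ≤ t → t ≤ s →
      EqOn (fun τ => f (ξ τ) + g (ξ τ) (w₁ τ)) F (uIoc 0 t) := by
    intro t ht hts τ hτ
    rw [uIoc_of_le ht] at hτ
    simp [hF, hτ.2.trans hts]
  -- The half-open interval leaves out `τ = s`, where the concatenation still follows the first
  -- piece.
  have hF₂ : ∀ t, s ≤ t →
      EqOn (fun τ => f (ζ (τ - s)) + g (ζ (τ - s)) (w₂ (τ - s))) F (uIoc s t) := by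
    intro t hts τ hτ
    rw [uIoc_of_le hts] at hτ
    simp [hF, not_le.2 hτ.1]
  have hi₁ : ∀ t, 0 ≤ t → t ≤ s → IntervalIntegrable F volume 0 t := fun t ht hts =>
    (h₁ t ht).2.1.congr (hF₁ t ht hts)
  have hv₁ : ∀ t, 0 ≤ t → t ≤ s → ξ t = x + ∫ τ in (0 : ℝ)..t, F τ := fun t ht hts => by
    rw [(h₁ t ht).2.2]
    congr 1
    exact intervalIntegral.integral_congr_ae (.of_forall fun τ hτ => hF₁ t ht hts hτ)
  intro t ht
  by_cases hts : t ≤ s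
  · simp only [hts, if_true]
    exact ⟨h₁.mem ht, hi₁ t ht hts, hv₁ t ht hts⟩
  · have hst : s ≤ t := (not_le.1 hts).le
    have hi₂ : IntervalIntegrable F volume s t := by
      have h3 := (h₂ (t - s) (by linarith)).2.1.comp_sub_right s
      simp only [zero_add, sub_add_cancel] at h3
      exact h3.congr (hF₂ t hst)
    simp only [hts, if_false]
    refine ⟨h₂.mem (by linarith), (hi₁ s hs le_rfl).trans hi₂, ?_⟩
    rw [← intervalIntegral.integral_add_adjacent_intervals (hi₁ s hs le_rfl) hi₂, ← add_assoc,
      ← hv₁ s hs le_rfl, (h₂ (t - s) (by linarith)).2.2]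
    congr 1
    have h4 := intervalIntegral.integral_comp_sub_right (a := s) (b := t)
      (fun τ => f (ζ τ) + g (ζ τ) (w₂ τ)) s
    rw [sub_self] at h4
    rw [← h4]
    exact intervalIntegral.integral_congr_ae (.of_forall fun τ hτ => hF₂ t hst hτ)

theorem IsControl.shift (hw : IsControl U w) {s : ℝ} (hs : 0 ≤ s) :
    IsControl U (fun t => w (s + t)) :=
  ⟨hw.1.comp (measurable_const_add s), fun t ht => hw.2 _ (by linarith)⟩

theorem IsControl.concat (h₁ : IsControl U w₁) (h₂ : IsControl U w₂) (s : ℝ) :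
    IsControl U (fun t => if t ≤ s then w₁ t else w₂ (t - s)) := by
  refine ⟨Measurable.ite measurableSet_Iic h₁.1 (h₂.1.comp (measurable_sub_const s)), ?_⟩
  intro t ht
  by_cases hts : t ≤ s
  · simpa [hts] using h₁.2 t ht
  · simpa [hts] using h₂.2 (t - s) (by linarith [not_le.1 hts])

theorem isControl_const {u : EuclideanSpace ℝ (Fin m)} (hu : u ∈ U) :
    IsControl U (fun _ => u) :=
  ⟨measurable_const, fun _ _ => hu⟩

theorem WellPosed.exists_isTrajectory (hwp : WellPosed X U f g) (hx : x ∈ X)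
    (hw : IsControl U w) : ∃ ξ, IsTrajectory X f g x w ξ :=
  (hwp x hx w hw).imp fun _ h => h.1

theorem WellPosed.isTrajectory_state (hwp : WellPosed X U f g) (hx : x ∈ X)
    (hw : IsControl U w) : IsTrajectory X f g x w (state X f g x w) := by
  have h := hwp.exists_isTrajectory hx hw
  rw [state, dif_pos h]
  exact h.choose_spec

theorem WellPosed.state_eqOn (hwp : WellPosed X U f g) (hx : x ∈ X)
    (hw : IsControl U w) (h : IsTrajectory X f g x w ξ) :
    EqOn (state X f g x w) ξ (Ici 0) := by
  obtain ⟨η, -, hη⟩ := hwp x hx w hw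
  exact (hη _ (hwp.isTrajectory_state hx hw)).trans (hη _ h).symm

/-! ### Discounted outputs -/

theorem runningTerm_congr {t : ℝ} (ht : 0 ≤ t) (h : EqOn ξ ζ (Icc 0 t)) :
    runningTerm lam c ξ t = runningTerm lam c ζ t := by
  refine intervalIntegral.integral_congr fun τ hτ => ?_
  rw [uIcc_of_le ht] at hτ
  simp only [h hτ]

theorem discountedOutput_congr {t : ℝ} (ht : 0 ≤ t) (h : EqOn ξ ζ (Icc 0 t)) :
    discountedOutput lam c ξ t = discountedOutput lam c ζ t := by
  rw [discountedOutput, discountedOutput, runningTerm_congr ht h, h ⟨ht, le_rfl⟩]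

@[simp]
theorem runningTerm_zero : runningTerm lam c ξ 0 = 0 := by simp [runningTerm]

@[simp]
theorem discountedOutput_zero : discountedOutput lam c ξ 0 = c (ξ 0) := by
  simp [discountedOutput]

theorem IsTrajectory.continuousOn_output (h : IsTrajectory X f g x w ξ) (hc : ContinuousOn c X) :
    ContinuousOn (fun t => c (ξ t)) (Ici 0) :=
  hc.comp h.continuousOn fun _ ht => h.mem ht

theorem IsTrajectory.continuousOn_integrand (h : IsTrajectory X f g x w ξ)
    (hc : ContinuousOn c X) :
    ContinuousOn (fun t => lam * Real.exp (-lam * t) * c (ξ t)) (Ici 0) :=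
  (by fun_prop : Continuous fun t : ℝ => lam * Real.exp (-lam * t)).continuousOn.mul
    (h.continuousOn_output hc)

theorem IsTrajectory.intervalIntegrable_integrand (h : IsTrajectory X f g x w ξ)
    (hc : ContinuousOn c X) {s t : ℝ} (hs : 0 ≤ s) (ht : 0 ≤ t) :
    IntervalIntegrable (fun t => lam * Real.exp (-lam * t) * c (ξ t)) volume s t :=
  ((h.continuousOn_integrand hc).mono fun _ hτ => (le_min hs ht).trans hτ.1).intervalIntegrable

/-- The weight `e^{-λτ}` is multiplicative in time, so the output after time `s` is the output of
the shifted trajectory scaled by `e^{-λs}`. Both halves of dynamic programming rest on this. -/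
theorem IsTrajectory.discountedOutput_add (h : IsTrajectory X f g x w ξ)
    (hc : ContinuousOn c X) {s t : ℝ} (hs : 0 ≤ s) (ht : 0 ≤ t) :
    discountedOutput lam c ξ (s + t) = runningTerm lam c ξ s +
      Real.exp (-lam * s) * discountedOutput lam c (fun t => ξ (s + t)) t := by
  have hst : 0 ≤ s + t := by linarith
  have hexp : ∀ τ, Real.exp (-lam * (s + τ)) = Real.exp (-lam * s) * Real.exp (-lam * τ) :=
    fun τ => by rw [← Real.exp_add]; ring_nf
  have h1 := intervalIntegral.integral_comp_add_left (a := 0) (b := t)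
    (fun τ => lam * Real.exp (-lam * τ) * c (ξ τ)) s
  rw [add_zero] at h1
  rw [discountedOutput, discountedOutput, runningTerm,
    ← intervalIntegral.integral_add_adjacent_intervals
      (h.intervalIntegrable_integrand hc le_rfl hs) (h.intervalIntegrable_integrand hc hs hst),
    ← h1, runningTerm, runningTerm, hexp, mul_add, ← intervalIntegral.integral_const_mul, add_assoc]
  congr 2
  · refine intervalIntegral.integral_congr fun τ _ => ?_
    simp only [hexp]
    ring
  · ring

theorem IsTrajectory.hasDerivWithinAt_runningTerm (h : IsTrajectory X f g x w ξ)
    (hc : ContinuousOn c X) :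
    HasDerivWithinAt (runningTerm lam c ξ) (lam * c x) (Ici 0) 0 := by
  have h1 := h.continuousOn_integrand (lam := lam) hc
  have := intervalIntegral.integral_hasDerivWithinAt_right (a := 0) (b := 0) (s := Ici 0)
    (t := Ioi 0)
    (h.intervalIntegrable_integrand (lam := lam) hc le_rfl le_rfl)
    ⟨_, Ioc_mem_nhdsGT one_pos,
      ((h1.mono (Ioc_subset_Icc_self.trans Icc_subset_Ici_self)).aestronglyMeasurable
        measurableSet_Ioc)⟩
    ((h1 0 self_mem_Ici).mono Ioi_subset_Ici_self)
  exact this.congr_deriv (by simp [h.apply_zero])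

/-- Used with `φ = c ∘ ξ` for the discounted output and with `φ = V ∘ ξ` for the continuation term.
-/
theorem hasDerivWithinAt_discount {φ : ℝ → ℝ} {d : ℝ} {r : ℝ → ℝ} {d' : ℝ}
    (hr : HasDerivWithinAt r d' (Ici 0) 0) (hφ : HasDerivWithinAt φ d (Ici 0) 0) :
    HasDerivWithinAt (fun t => r t + Real.exp (-lam * t) * φ t) (d' + (d - lam * φ 0))
      (Ici 0) 0 := by
  have h1 : HasDerivWithinAt (fun t => Real.exp (-lam * t)) (-lam) (Ici 0) 0 := by
    have := (((hasDerivAt_id (0 : ℝ)).const_mul (-lam)).exp).hasDerivWithinAt (s := Ici 0)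
    simpa using this
  refine (hr.add (h1.mul hφ)).congr_deriv ?_
  simp
  ring

/-- The velocity at time `0` of a trajectory with constant control. -/
theorem IsTrajectory.hasDerivWithinAt_zero {u : EuclideanSpace ℝ (Fin m)}
    (h : IsTrajectory X f g x (fun _ => u) ξ) (hf : ContinuousOn f X) (hg : ContinuousOn g X) :
    HasDerivWithinAt ξ (f x + g x u) (Ici 0) 0 := by
  have h1 : ContinuousOn (fun τ => f (ξ τ) + g (ξ τ) u) (Ici 0) :=
    (hf.comp h.continuousOn fun _ ht => h.mem ht).add
      ((hg.comp h.continuousOn fun _ ht => h.mem ht).clm_apply continuousOn_const)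
  have := (intervalIntegral.integral_hasDerivWithinAt_right (a := 0) (b := 0) (s := Ici 0)
    (t := Ioi 0) (h 0 le_rfl).2.1
    ⟨_, Ioc_mem_nhdsGT one_pos,
      ((h1.mono (Ioc_subset_Icc_self.trans Icc_subset_Ici_self)).aestronglyMeasurable
        measurableSet_Ioc)⟩
    ((h1 0 self_mem_Ici).mono Ioi_subset_Ici_self)).const_add x
  rw [h.apply_zero] at this
  exact this.congr (fun t ht => (h t ht).2.2) (h 0 le_rfl).2.2

theorem IsTrajectory.hasDerivWithinAt_comp {u : EuclideanSpace ℝ (Fin m)}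
    (h : IsTrajectory X f g x (fun _ => u) ξ) (hf : ContinuousOn f X) (hg : ContinuousOn g X)
    {φ : EuclideanSpace ℝ (Fin n) → ℝ} (hx : x ∈ X) (hφ : DifferentiableOn ℝ φ X) :
    HasDerivWithinAt (fun t => φ (ξ t)) (fderivWithin ℝ φ X x (f x + g x u)) (Ici 0) 0 := by
  have h1 := (hφ x hx).hasFDerivWithinAt
  rw [← h.apply_zero] at h1
  have h2 := HasFDerivWithinAt.comp_hasDerivWithinAt (t := X) 0 h1
    (h.hasDerivWithinAt_zero hf hg) (fun _ ht => h.mem ht)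
  rw [h.apply_zero] at h2
  exact h2

/-! ### The value function -/

/-- Time `0` competes in every infimum. In particular the value is never `⊤` on `X`, so excluding
`⊥` is enough for finiteness. -/
theorem WellPosed.extValue_le (hwp : WellPosed X U f g) (hx : x ∈ X) :
    extValue X U f g c lam x ≤ (c x : EReal) := by
  refine iSup₂_le fun w hw => iInf₂_le_of_le 0 le_rfl ?_
  rw [discountedOutput_zero, (hwp.isTrajectory_state hx hw).apply_zero]

theorem WellPosed.coe_value (hwp : WellPosed X U f g) (hx : x ∈ X)
    (hfin : extValue X U f g c lam x ≠ ⊥) :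
    (value X U f g c lam x : EReal) = extValue X U f g c lam x :=
  EReal.coe_toReal ((hwp.extValue_le hx).trans_lt (EReal.coe_lt_top _)).ne hfin

theorem WellPosed.value_le (hwp : WellPosed X U f g) (hx : x ∈ X)
    (hfin : extValue X U f g c lam x ≠ ⊥) : value X U f g c lam x ≤ c x := by
  rw [← EReal.coe_le_coe_iff, hwp.coe_value hx hfin]
  exact hwp.extValue_le hx

/-- Uniqueness of trajectories allows any trajectory, such as a concatenation or a tail, in place of
the chosen `state`. -/
theorem WellPosed.le_value (hwp : WellPosed X U f g) (hx : x ∈ X)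
    (hfin : extValue X U f g c lam x ≠ ⊥) (hw : IsControl U w) (h : IsTrajectory X f g x w ξ)
    {r : ℝ} (hr : ∀ t, 0 ≤ t → r ≤ discountedOutput lam c ξ t) :
    r ≤ value X U f g c lam x := by
  rw [← EReal.coe_le_coe_iff, hwp.coe_value hx hfin]
  refine le_iSup₂_of_le w hw (le_iInf₂ fun t ht => ?_)
  rw [discountedOutput_congr ht ((hwp.state_eqOn hx hw h).mono Icc_subset_Ici_self)]
  exact EReal.coe_le_coe_iff.2 (hr t ht)

theorem WellPosed.exists_of_lt_value (hwp : WellPosed X U f g) (hx : x ∈ X)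
    (hfin : extValue X U f g c lam x ≠ ⊥) {r : ℝ} (hr : r < value X U f g c lam x) :
    ∃ w ξ, IsControl U w ∧ IsTrajectory X f g x w ξ ∧
      ∀ t, 0 ≤ t → r ≤ discountedOutput lam c ξ t := by
  rw [← EReal.coe_lt_coe_iff, hwp.coe_value hx hfin, extValue] at hr
  obtain ⟨w, hw⟩ := lt_iSup_iff.1 hr
  obtain ⟨hwc, hw⟩ := lt_iSup_iff.1 hw
  refine ⟨w, _, hwc, hwp.isTrajectory_state hx hwc, fun t ht => ?_⟩
  exact EReal.coe_le_coe_iff.1 (hw.le.trans (iInf₂_le t ht))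

/-- Lower half of the dynamic programming principle. -/
theorem WellPosed.le_value_of_forall_le (hwp : WellPosed X U f g)
    (hfin : ∀ x ∈ X, extValue X U f g c lam x ≠ ⊥) (hc : ContinuousOn c X) (hx : x ∈ X)
    (hw : IsControl U w) (h : IsTrajectory X f g x w ξ) {s r : ℝ} (hs : 0 ≤ s)
    (hr : ∀ t ∈ Icc 0 s, r ≤ discountedOutput lam c ξ t)
    (hr' : r ≤ runningTerm lam c ξ s + Real.exp (-lam * s) * value X U f g c lam (ξ s)) :
    r ≤ value X U f g c lam x := by
  refine le_of_forall_pos_sub_le fun ε hε => ?_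
  have hexp := Real.exp_pos (-lam * s)
  -- The tolerance `ε / e^{-λs}` becomes exactly `ε` after discounting by `e^{-λs}`.
  obtain ⟨w₂, ζ, hw₂, hζ, hζr⟩ := hwp.exists_of_lt_value (h.mem hs) (hfin _ (h.mem hs))
    (sub_lt_self (value X U f g c lam (ξ s)) (div_pos hε hexp))
  have hη := h.concat hs hζ
  refine hwp.le_value hx (hfin x hx) (hw.concat hw₂ s) hη fun t ht => ?_
  have heq : ∀ t, t ≤ s → EqOn (fun t => if t ≤ s then ξ t else ζ (t - s)) ξ (Icc 0 t) :=
    fun t hts τ hτ => by simp [hτ.2.trans hts]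
  by_cases hts : t ≤ s
  · rw [discountedOutput_congr ht (heq t hts)]
    linarith [hr t ⟨ht, hts⟩]
  · have hts' : 0 ≤ t - s := by linarith
    have h1 := hη.discountedOutput_add (lam := lam) hc hs hts'
    rw [add_sub_cancel, runningTerm_congr hs (heq s le_rfl)] at h1
    rw [h1, discountedOutput_congr (ζ := ζ) hts']
    · have h2 := mul_le_mul_of_nonneg_left (hζr _ hts') hexp.le
      rw [mul_sub, mul_div_cancel₀ _ hexp.ne'] at h2
      linarith
    · intro τ hτ
      -- At the junction the concatenation takes the value `ξ s`, which equals `ζ 0`.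
      rcases hτ.1.eq_or_lt with rfl | h0
      · simp [hζ.apply_zero]
      · simp [h0]

/-- Upper half of the dynamic programming principle. -/
theorem WellPosed.le_of_forall_le_discountedOutput (hwp : WellPosed X U f g)
    (hfin : ∀ x ∈ X, extValue X U f g c lam x ≠ ⊥) (hc : ContinuousOn c X)
    (hw : IsControl U w) (h : IsTrajectory X f g x w ξ) {s r : ℝ} (hs : 0 ≤ s)
    (hr : ∀ t, 0 ≤ t → r ≤ discountedOutput lam c ξ t) :
    r ≤ runningTerm lam c ξ s + Real.exp (-lam * s) * value X U f g c lam (ξ s) := by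
  have hexp := Real.exp_pos (-lam * s)
  have : (r - runningTerm lam c ξ s) / Real.exp (-lam * s) ≤ value X U f g c lam (ξ s) := by
    refine hwp.le_value (h.mem hs) (hfin _ (h.mem hs)) (hw.shift hs) (h.shift hs) fun t ht => ?_
    rw [div_le_iff₀' hexp]
    have h1 := hr (s + t) (by linarith)
    rw [h.discountedOutput_add hc hs ht] at h1
    linarith
  rw [div_le_iff₀' hexp] at this
  linarith

/-! ### Uniform short-time estimates -/

theorem exists_forall_velocity_le (hUbdd : Bornology.IsBounded U) (hf : ContinuousOn f X)
    (hg : ContinuousOn g X) (hx : x ∈ X) :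
    ∃ M, 0 < M ∧ ∀ᶠ y in 𝓝[X] x, ∀ u ∈ U, ‖f y + g y u‖ ≤ M := by
  obtain ⟨R, hR0, hR⟩ := hUbdd.exists_pos_norm_le
  refine ⟨‖f x‖ + 1 + (‖g x‖ + 1) * R, by positivity, ?_⟩
  filter_upwards [(hf x hx).norm.eventually (gt_mem_nhds (lt_add_one _)),
    (hg x hx).norm.eventually (gt_mem_nhds (lt_add_one _))] with y hy1 hy2 u hu
  refine (norm_add_le _ _).trans (add_le_add hy1.le ?_)
  exact ((g y).le_opNorm u).trans (mul_le_mul hy2.le (hR u hu) (norm_nonneg _) (by positivity))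

/-- A property that holds near `x` in `X` holds along all trajectories from `x` up to a common
positive time. -/
theorem exists_forall_trajectory (hUbdd : Bornology.IsBounded U) (hf : ContinuousOn f X)
    (hg : ContinuousOn g X) (hx : x ∈ X) {P : EuclideanSpace ℝ (Fin n) → Prop}
    (hP : ∀ᶠ y in 𝓝[X] x, P y) :
    ∃ s > 0, ∀ w, IsControl U w → ∀ ξ, IsTrajectory X f g x w ξ → ∀ t ∈ Icc 0 s, P (ξ t) := by
  obtain ⟨M, hM, hMX⟩ := exists_forall_velocity_le hUbdd hf hg hx
  obtain ⟨δ, hδ, hball⟩ := Metric.mem_nhdsWithin_iff.1 (hP.and hMX)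
  -- At speed at most `M`, the distance covered by this time is at most `δ / 2`, too short to leave
  -- the ball.
  refine ⟨δ / (2 * M), by positivity, fun w hw ξ h => ?_⟩
  have key : ∀ t ∈ Icc 0 (δ / (2 * M)), ξ t ∈ Metric.ball x δ := by
    by_contra! hcon
    set K := {t ∈ Icc 0 (δ / (2 * M)) | δ ≤ dist (ξ t) x} with hK
    have hcont : ContinuousOn (fun t => dist (ξ t) x) (Icc 0 (δ / (2 * M))) :=
      (continuous_id.dist continuous_const).comp_continuousOn
        (h.continuousOn.mono Icc_subset_Ici_self)
    have hKc : IsCompact K :=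
      isCompact_Icc.of_isClosed_subset (hcont.preimage_isClosed_of_isClosed isClosed_Icc
        isClosed_Ici) fun _ ht => ht.1
    have hKne : K.Nonempty := by
      obtain ⟨t, ht, ht'⟩ := hcon
      exact ⟨t, ht, by simpa using ht'⟩
    -- First exit time `T`: the speed bound holds strictly before `T`, and the single point `T` is
    -- null for the integral.
    obtain ⟨T, ⟨hTs, hTd⟩, hTle⟩ := hKc.exists_isLeast hKne
    have hbd : ‖∫ τ in (0 : ℝ)..T, (f (ξ τ) + g (ξ τ) (w τ))‖ ≤ M * |T - 0| := by
      refine intervalIntegral.norm_integral_le_of_norm_le_const_ae ?_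
      filter_upwards [compl_mem_ae_iff.2 (measure_singleton T)] with τ hτT hτ
      rw [uIoc_of_le hTs.1] at hτ
      have hlt : τ < T := lt_of_le_of_ne hτ.2 hτT
      have hmem : ξ τ ∈ Metric.ball x δ := by
        by_contra hn
        exact absurd (hTle ⟨⟨hτ.1.le, hτ.2.trans hTs.2⟩, by simpa using hn⟩) (not_le.2 hlt)
      exact (hball ⟨hmem, h.mem hτ.1.le⟩).2 _ (hw.2 τ hτ.1.le)
    have hT : dist (ξ T) x ≤ M * T := by
      rw [dist_eq_norm, (h T hTs.1).2.2, add_sub_cancel_left]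
      simpa [abs_of_nonneg hTs.1] using hbd
    have h2 : M * T ≤ δ / 2 := by
      have := mul_le_mul_of_nonneg_left hTs.2 hM.le
      have h3 : M * (δ / (2 * M)) = δ / 2 := by field_simp
      linarith
    linarith
  exact fun t ht => (hball ⟨key t ht, h.mem ht.1⟩).1

theorem exists_forall_norm_sub_le (hUbdd : Bornology.IsBounded U) (hf : ContinuousOn f X)
    (hg : ContinuousOn g X) (hx : x ∈ X) :
    ∃ M > 0, ∃ s > 0, ∀ w, IsControl U w → ∀ ξ, IsTrajectory X f g x w ξ →
      ∀ t ∈ Icc 0 s, ‖ξ t - x‖ ≤ M * t := by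
  obtain ⟨M, hM, hMX⟩ := exists_forall_velocity_le hUbdd hf hg hx
  obtain ⟨s, hs, H⟩ := exists_forall_trajectory hUbdd hf hg hx hMX
  refine ⟨M, hM, s, hs, fun w hw ξ h t ht => ?_⟩
  rw [(h t ht.1).2.2, add_sub_cancel_left]
  have := intervalIntegral.norm_integral_le_of_norm_le_const (a := 0) (b := t) (C := M)
    (f := fun τ => f (ξ τ) + g (ξ τ) (w τ)) fun τ hτ => by
      rw [uIoc_of_le ht.1] at hτ
      exact H w hw ξ h τ ⟨hτ.1.le, hτ.2.trans ht.2⟩ _ (hw.2 τ hτ.1.le)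
  simpa [abs_of_nonneg ht.1] using this

theorem eventually_forall_clm_velocity_le (hUbdd : Bornology.IsBounded U) (hf : ContinuousOn f X)
    (hg : ContinuousOn g X) (hx : x ∈ X) (L : EuclideanSpace ℝ (Fin n) →L[ℝ] ℝ) {a ε : ℝ}
    (hε : 0 < ε) (ha : ∀ u ∈ U, L (f x + g x u) ≤ a) :
    ∀ᶠ y in 𝓝[X] x, ∀ u ∈ U, L (f y + g y u) ≤ a + ε := by
  obtain ⟨R, hR0, hR⟩ := hUbdd.exists_pos_norm_le
  have h1 : Tendsto (fun y => ‖L‖ * (‖f y - f x‖ + ‖g y - g x‖ * R)) (𝓝[X] x) (𝓝 0) := by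
    have : ContinuousWithinAt (fun y => ‖L‖ * (‖f y - f x‖ + ‖g y - g x‖ * R)) X x :=
      continuousWithinAt_const.mul ((((hf x hx).sub continuousWithinAt_const).norm).add
        ((((hg x hx).sub continuousWithinAt_const).norm).mul continuousWithinAt_const))
    simpa [ContinuousWithinAt] using this
  filter_upwards [h1.eventually (gt_mem_nhds hε)] with y hy u hu
  have h2 : L (f y + g y u) = L (f x + g x u) + L ((f y - f x) + (g y - g x) u) := by
    rw [← map_add, sub_apply]
    congr 1
    abel
  have h3 : L ((f y - f x) + (g y - g x) u) ≤ ‖L‖ * (‖f y - f x‖ + ‖g y - g x‖ * R) := by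
    refine (le_abs_self _).trans ((L.le_opNorm _).trans
      (mul_le_mul_of_nonneg_left ((norm_add_le _ _).trans ?_) (norm_nonneg _)))
    gcongr
    exact ((g y - g x).le_opNorm u).trans
      (mul_le_mul_of_nonneg_left (hR u hu) (norm_nonneg _))
  linarith [ha u hu]

/-- Uniform upper bound for the growth of a differentiable function along trajectories. -/
theorem exists_forall_comp_sub_le (hUbdd : Bornology.IsBounded U) (hf : ContinuousOn f X)
    (hg : ContinuousOn g X) (hx : x ∈ X) {φ : EuclideanSpace ℝ (Fin n) → ℝ}
    {L : EuclideanSpace ℝ (Fin n) →L[ℝ] ℝ} (hφ : HasFDerivWithinAt φ L X x) {a ε : ℝ}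
    (hε : 0 < ε) (ha : ∀ u ∈ U, L (f x + g x u) ≤ a) :
    ∃ s > 0, ∀ w, IsControl U w → ∀ ξ, IsTrajectory X f g x w ξ →
      ∀ t ∈ Icc 0 s, φ (ξ t) - φ x ≤ (a + ε) * t := by
  obtain ⟨M, hM, s₁, hs₁, H₁⟩ := exists_forall_norm_sub_le hUbdd hf hg hx
  obtain ⟨s₂, hs₂, H₂⟩ := exists_forall_trajectory hUbdd hf hg hx
    (eventually_forall_clm_velocity_le hUbdd hf hg hx L (half_pos hε) ha)
  -- Since `‖ξ t - x‖ ≤ M t`, the factor `ε / 2 / M` turns the differentiability remainder into at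
  -- most `(ε / 2) t`.
  obtain ⟨s₃, hs₃, H₃⟩ := exists_forall_trajectory hUbdd hf hg hx
    (hφ.isLittleO.def (show 0 < ε / 2 / M by positivity))
  refine ⟨min s₁ (min s₂ s₃), by positivity, fun w hw ξ h t ht => ?_⟩
  have ht₁ : t ∈ Icc 0 s₁ := ⟨ht.1, ht.2.trans (min_le_left _ _)⟩
  have ht₂ : t ∈ Icc 0 s₂ := ⟨ht.1, ht.2.trans ((min_le_right _ _).trans (min_le_left _ _))⟩
  have ht₃ : t ∈ Icc 0 s₃ := ⟨ht.1, ht.2.trans ((min_le_right _ _).trans (min_le_right _ _))⟩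
  have h1 : L (ξ t - x) ≤ (a + ε / 2) * t := by
    rw [(h t ht.1).2.2, add_sub_cancel_left,
      ← L.intervalIntegral_comp_comm (h t ht.1).2.1]
    have hint : IntervalIntegrable (fun τ => L (f (ξ τ) + g (ξ τ) (w τ))) volume 0 t :=
      ⟨L.integrable_comp (h t ht.1).2.1.1, L.integrable_comp (h t ht.1).2.1.2⟩
    have := intervalIntegral.integral_mono_on ht.1 hint
      (intervalIntegrable_const (c := a + ε / 2)) fun τ hτ =>
        H₂ w hw ξ h τ ⟨hτ.1, hτ.2.trans ht₂.2⟩ _ (hw.2 τ hτ.1)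
    rwa [intervalIntegral.integral_const, sub_zero, smul_eq_mul, mul_comm] at this
  have h2 := (le_abs_self _).trans (H₃ w hw ξ h t ht₃)
  have h3 : ε / 2 / M * ‖ξ t - x‖ ≤ ε / 2 * t := by
    refine (mul_le_mul_of_nonneg_left (H₁ w hw ξ h t ht₁) (by positivity)).trans_eq ?_
    field_simp
  linarith

/-- Near `x` the output is at most `c x + ε`, and the nonnegative weight `λ e^{-λτ}` has mass `1 -
e^{-λt}` on `[0, t]`. -/
theorem exists_forall_runningTerm_le (hUbdd : Bornology.IsBounded U) (hf : ContinuousOn f X)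
    (hg : ContinuousOn g X) (hx : x ∈ X) (hc : ContinuousOn c X) (hlam : 0 ≤ lam) {ε : ℝ}
    (hε : 0 < ε) :
    ∃ s > 0, ∀ w, IsControl U w → ∀ ξ, IsTrajectory X f g x w ξ →
      ∀ t ∈ Icc 0 s, runningTerm lam c ξ t ≤ (1 - Real.exp (-lam * t)) * (c x + ε) := by
  obtain ⟨s, hs, H⟩ := exists_forall_trajectory hUbdd hf hg hx
    ((hc x hx).eventually (ge_mem_nhds (lt_add_of_pos_right (c x) hε)))
  refine ⟨s, hs, fun w hw ξ h t ht => ?_⟩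
  have hcont : Continuous fun τ : ℝ => lam * Real.exp (-lam * τ) := by fun_prop
  have h1 : ∫ τ in (0 : ℝ)..t, lam * Real.exp (-lam * τ) = 1 - Real.exp (-lam * t) := by
    rw [intervalIntegral.integral_eq_sub_of_hasDerivAt (f := fun τ => -Real.exp (-lam * τ))]
    · simp; ring
    · intro τ _
      have := (((hasDerivAt_id τ).const_mul (-lam)).exp).neg
      refine this.congr_deriv ?_
      simp; ring
    · exact hcont.intervalIntegrable _ _
  rw [← h1, ← intervalIntegral.integral_mul_const]
  refine intervalIntegral.integral_mono_on ht.1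
    (h.intervalIntegrable_integrand hc le_rfl ht.1)
    ((hcont.mul continuous_const).intervalIntegrable _ _) fun τ hτ => ?_
  exact mul_le_mul_of_nonneg_left (H w hw ξ h τ ⟨hτ.1, hτ.2.trans ht.2⟩) (by positivity)

theorem tendsto_one_sub_exp_div :
    Tendsto (fun s : ℝ => (1 - Real.exp (-lam * s)) / s) (𝓝[>] 0) (𝓝 lam) := by
  have h := (((hasDerivAt_id (0 : ℝ)).const_mul (-lam)).exp.const_sub 1).tendsto_slope
  have h' := h.mono_left (nhdsGT_le_nhdsNE (0 : ℝ))
  refine (h'.congr fun s => ?_).trans_eq (by simp)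
  simp [slope_def_field]

/-- If the derivative of the value along every admissible velocity is at most `a`, then `a` is at
least the discount rate `λ (V - c)`. -/
theorem WellPosed.le_of_forall_fderivWithin_le (hwp : WellPosed X U f g)
    (hUbdd : Bornology.IsBounded U) (hf : ContinuousOn f X) (hg : ContinuousOn g X)
    (hfin : ∀ x ∈ X, extValue X U f g c lam x ≠ ⊥) (hc : ContinuousOn c X) (hlam : 0 ≤ lam)
    (hV : DifferentiableOn ℝ (value X U f g c lam) X) (hx : x ∈ X) {a : ℝ}
    (ha : ∀ u ∈ U, fderivWithin ℝ (value X U f g c lam) X x (f x + g x u) ≤ a) :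
    lam * (value X U f g c lam x - c x) ≤ a := by
  set V := value X U f g c lam with hVdef
  have key : ∀ ε > 0, lam * (V x - c x - ε) ≤ a + ε + ε := by
    intro ε hε
    obtain ⟨s₁, hs₁, H₁⟩ :=
      exists_forall_comp_sub_le hUbdd hf hg hx (hV x hx).hasFDerivWithinAt hε ha
    obtain ⟨s₂, hs₂, H₂⟩ := exists_forall_runningTerm_le hUbdd hf hg hx hc hlam hε
    have hlim1 : Tendsto (fun s : ℝ => (1 - Real.exp (-lam * s)) / s * (V x - c x - ε)) (𝓝[>] 0)
        (𝓝 (lam * (V x - c x - ε))) := tendsto_one_sub_exp_div.mul_const _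
    have hlim2 : Tendsto (fun s : ℝ => Real.exp (-lam * s) * (a + ε) + ε) (𝓝[>] 0)
        (𝓝 (a + ε + ε)) := by
      have : Continuous fun s : ℝ => Real.exp (-lam * s) * (a + ε) + ε := by fun_prop
      have h0 := (this.tendsto 0).mono_left (nhdsWithin_le_nhds (s := Ioi 0))
      simpa using h0
    refine le_of_tendsto_of_tendsto hlim1 hlim2 ?_
    filter_upwards [Ioc_mem_nhdsGT (lt_min hs₁ hs₂)] with s hs
    -- The suboptimality is `ε s`, proportional to `s`, so that dividing by `s` leaves only `ε`.
    obtain ⟨w, ξ, hw, h, hr⟩ := hwp.exists_of_lt_value hx (hfin x hx)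
      (sub_lt_self (V x) (mul_pos hε hs.1))
    have h1 := hwp.le_of_forall_le_discountedOutput hfin hc hw h hs.1.le hr
    have h2 := H₁ w hw ξ h s ⟨hs.1.le, hs.2.trans (min_le_left _ _)⟩
    have h3 := H₂ w hw ξ h s ⟨hs.1.le, hs.2.trans (min_le_right _ _)⟩
    have h4 := mul_le_mul_of_nonneg_left h2 (Real.exp_pos (-lam * s)).le
    rw [div_mul_eq_mul_div, div_le_iff₀ hs.1]
    rw [← hVdef] at h1
    linarith
  have hlim1 : Tendsto (fun ε : ℝ => lam * (V x - c x - ε)) (𝓝[>] 0) (𝓝 (lam * (V x - c x))) := by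
    have : Continuous fun ε : ℝ => lam * (V x - c x - ε) := by fun_prop
    simpa using (this.tendsto 0).mono_left (nhdsWithin_le_nhds (s := Ioi 0))
  have hlim2 : Tendsto (fun ε : ℝ => a + ε + ε) (𝓝[>] 0) (𝓝 a) := by
    have : Continuous fun ε : ℝ => a + ε + ε := by fun_prop
    simpa using (this.tendsto 0).mono_left (nhdsWithin_le_nhds (s := Ioi 0))
  exact le_of_tendsto_of_tendsto hlim1 hlim2 (eventually_nhdsWithin_of_forall key)

/-! ### The advantage -/

theorem tendsto_quotient_of_hasDerivWithinAt {φ : ℝ → ℝ} {d : ℝ}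
    (h : HasDerivWithinAt φ d (Ici 0) 0) :
    Tendsto (fun s => (φ s - φ 0) / s) (𝓝[>] 0) (𝓝 d) := by
  have h1 := hasDerivWithinAt_iff_tendsto_slope.1 h
  rw [Ici_sdiff_left] at h1
  refine h1.congr fun s => ?_
  simp [slope_def_field]

/-- One-sided derivative at `0` of the running minimum. -/
theorem tendsto_sInf_quotient_of_hasDerivWithinAt {φ : ℝ → ℝ} {d : ℝ}
    (h : HasDerivWithinAt φ d (Ici 0) 0) (hφ : ContinuousOn φ (Ici 0)) :
    Tendsto (fun s => (sInf (φ '' Icc 0 s) - φ 0) / s) (𝓝[>] 0) (𝓝 (min 0 d)) := by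
  have hle : ∀ s t : ℝ, t ∈ Icc 0 s → sInf (φ '' Icc 0 s) ≤ φ t := fun s t ht =>
    csInf_le (isCompact_Icc.bddBelow_image (hφ.mono Icc_subset_Ici_self)) (mem_image_of_mem φ ht)
  have hq := tendsto_quotient_of_hasDerivWithinAt h
  have hup : ∀ᶠ s in 𝓝[>] (0 : ℝ),
      (sInf (φ '' Icc 0 s) - φ 0) / s ≤ min 0 ((φ s - φ 0) / s) := by
    filter_upwards [self_mem_nhdsWithin] with s hs
    have hs : 0 < s := hs
    refine le_min (div_nonpos_of_nonpos_of_nonneg ?_ hs.le) ?_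
    · linarith [hle s 0 ⟨le_rfl, hs.le⟩]
    · gcongr
      exact hle s s ⟨hs.le, le_rfl⟩
  refine tendsto_order.2 ⟨fun a ha => ?_, fun a ha => ?_⟩
  · obtain ⟨a', haa', ha'⟩ := exists_between ha
    obtain ⟨s₀, hs₀, H⟩ := mem_nhdsGT_iff_exists_Ioc_subset.1
      (hq.eventually (lt_mem_nhds (ha'.trans_le (min_le_right _ _))))
    filter_upwards [Ioc_mem_nhdsGT hs₀] with s hs
    refine haa'.trans_le ?_
    rw [le_div_iff₀ hs.1, le_sub_iff_add_le]
    refine le_csInf ((nonempty_Icc.2 hs.1.le).image φ) ?_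
    rintro _ ⟨t, ht, rfl⟩
    -- As `a' < 0`, the bound `φ t ≥ φ 0 + a' t` on `[0, s]` is weakest at `t = s`, so it gives `φ 0
    -- + a' s` throughout.
    have ha0 : a' < 0 := ha'.trans_le (min_le_left _ _)
    rcases ht.1.eq_or_lt with rfl | h0
    · nlinarith [hs.1]
    · have h1 : a' < (φ t - φ 0) / t := H ⟨h0, ht.2.trans hs.2⟩
      rw [lt_div_iff₀ h0] at h1
      nlinarith [ht.2]
  · have := ((tendsto_const_nhds (x := (0 : ℝ))).min hq).eventually (gt_mem_nhds ha)
    filter_upwards [this, hup] with s h1 h2 using h2.trans_lt h1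

theorem eventually_le_sInf_image_Icc {φ : ℝ → ℝ} {a : ℝ} (hφ : ContinuousOn φ (Ici 0))
    (ha : a < φ 0) : ∀ᶠ s in 𝓝[>] (0 : ℝ), a ≤ sInf (φ '' Icc 0 s) := by
  obtain ⟨s₀, hs₀, H⟩ := mem_nhdsGE_iff_exists_Icc_subset.1
    ((hφ 0 self_mem_Ici).eventually (lt_mem_nhds ha))
  filter_upwards [Ioc_mem_nhdsGT hs₀] with s hs
  refine le_csInf ((nonempty_Icc.2 hs.1.le).image φ) ?_
  rintro _ ⟨t, ht, rfl⟩
  exact (H ⟨ht.1, ht.2.trans hs.2⟩ : a < φ t).le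

theorem IsTrajectory.continuousOn_discountedOutput (h : IsTrajectory X f g x w ξ)
    (hc : ContinuousOn c X) : ContinuousOn (discountedOutput lam c ξ) (Ici 0) := by
  refine ContinuousOn.add (fun t ht => ?_) ((by fun_prop :
    Continuous fun t : ℝ => Real.exp (-lam * t)).continuousOn.mul (h.continuousOn_output hc))
  have ht : 0 ≤ t := ht
  have h1 := intervalIntegral.continuousOn_primitive_interval'
    (h.intervalIntegrable_integrand (lam := lam) hc le_rfl (by linarith : 0 ≤ t + 1)) left_mem_uIcc
  rw [uIcc_of_le (by linarith)] at h1
  exact (h1 t ⟨ht, by linarith⟩).mono_of_mem_nhdsWithin Icc_zero_mem_nhdsWithin_Ici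

theorem WellPosed.stateActionValue_le (hwp : WellPosed X U f g)
    (hfin : ∀ x ∈ X, extValue X U f g c lam x ≠ ⊥) (hc : ContinuousOn c X) (hx : x ∈ X)
    {u : EuclideanSpace ℝ (Fin m)} (hu : u ∈ U) {s : ℝ} (hs : 0 ≤ s) :
    stateActionValue X U f g c lam s x u ≤ value X U f g c lam x := by
  have h := hwp.isTrajectory_state hx (isControl_const hu)
  refine hwp.le_value_of_forall_le hfin hc hx (isControl_const hu) h hs (fun t ht => ?_)
    (min_le_right _ _)
  exact (min_le_left _ _).trans (csInf_le (isCompact_Icc.bddBelow_image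
    ((h.continuousOn_discountedOutput hc).mono Icc_subset_Ici_self)) (mem_image_of_mem _ ht))

theorem WellPosed.advantageQuotient_nonpos (hwp : WellPosed X U f g)
    (hfin : ∀ x ∈ X, extValue X U f g c lam x ≠ ⊥) (hc : ContinuousOn c X) (hx : x ∈ X)
    {u : EuclideanSpace ℝ (Fin m)} (hu : u ∈ U) {s : ℝ} (hs : 0 ≤ s) :
    advantageQuotient X U f g c lam x u s ≤ 0 :=
  div_nonpos_of_nonpos_of_nonneg (sub_nonpos.2 (hwp.stateActionValue_le hfin hc hx hu hs)) hs

theorem WellPosed.tendsto_advantageQuotient (hwp : WellPosed X U f g)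
    (hf : ContinuousOn f X) (hg : ContinuousOn g X)
    (hfin : ∀ x ∈ X, extValue X U f g c lam x ≠ ⊥) (hc : DifferentiableOn ℝ c X)
    (hV : DifferentiableOn ℝ (value X U f g c lam) X) (hx : x ∈ X)
    {u : EuclideanSpace ℝ (Fin m)} (hu : u ∈ U) :
    Tendsto (advantageQuotient X U f g c lam x u) (𝓝[>] 0)
      (𝓝 (min (c x - value X U f g c lam x)
          (fderivWithin ℝ (value X U f g c lam) X x (f x + g x u) +
            lam * (c x - value X U f g c lam x)))) := by
  set ξ := state X f g x (fun _ => u) with hξ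
  have h : IsTrajectory X f g x (fun _ => u) ξ := hwp.isTrajectory_state hx (isControl_const hu)
  set V := value X U f g c lam with hVdef
  set D := discountedOutput lam c ξ with hD
  have hD0 : D 0 = c x := by rw [hD, discountedOutput_zero, h.apply_zero]
  have hDcont : ContinuousOn D (Ici 0) := h.continuousOn_discountedOutput hc.continuousOn
  have hrun := h.hasDerivWithinAt_runningTerm (lam := lam) hc.continuousOn
  have hVd := h.hasDerivWithinAt_comp hf hg hx hV
  have hcd := h.hasDerivWithinAt_comp hf hg hx hc
  set B : ℝ → ℝ := fun s => runningTerm lam c ξ s + Real.exp (-lam * s) * V (ξ s) with hB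
  have hB0 : B 0 = V x := by simp [hB, h.apply_zero]
  have hBd := hasDerivWithinAt_discount (lam := lam) hrun hVd
  have hDd := hasDerivWithinAt_discount (lam := lam) hrun hcd
  rw [h.apply_zero] at hBd hDd
  have hBq := tendsto_quotient_of_hasDerivWithinAt hBd
  change Tendsto (fun s => (B s - B 0) / s) _ _ at hBq
  rw [hB0] at hBq
  have hquot : ∀ s, advantageQuotient X U f g c lam x u s =
      (min (sInf (D '' Icc 0 s)) (B s) - V x) / s := fun s => rfl
  have hVc : V x ≤ c x := hwp.value_le hx (hfin x hx)
  rcases hVc.eq_or_lt with heq | hlt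
  -- Contact case `V x = c x`: both terms start from `V x`, so the quotient is the minimum of two
  -- convergent quotients.
  · have hDq := tendsto_sInf_quotient_of_hasDerivWithinAt hDd hDcont
    change Tendsto (fun s => (sInf (D '' Icc 0 s) - D 0) / s) _ _ at hDq
    rw [hD0, ← heq] at hDq
    have hdle : fderivWithin ℝ V X x (f x + g x u) ≤ fderivWithin ℝ c X x (f x + g x u) := by
      refine le_of_tendsto_of_tendsto (tendsto_quotient_of_hasDerivWithinAt hVd)
        (tendsto_quotient_of_hasDerivWithinAt hcd) ?_
      filter_upwards [self_mem_nhdsWithin] with s hs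
      have hs : 0 < s := hs
      have h1 : V (ξ s) ≤ c (ξ s) := hwp.value_le (h.mem hs.le) (hfin _ (h.mem hs.le))
      rw [h.apply_zero, heq]
      gcongr
    have hlim := hDq.min hBq
    refine (hlim.congr' ?_).trans_eq ?_
    · filter_upwards [self_mem_nhdsWithin] with s hs
      have hs : 0 < s := hs
      rw [hquot, min_div_div_right hs.le, min_sub_sub_right]
    · congr 1
      rw [← heq]
      have e1 : ∀ d : ℝ, lam * V x + (d - lam * V x) = d := fun d => by ring
      simp only [e1, sub_self, mul_zero, add_zero]
      rw [min_assoc, min_eq_right hdle]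
  -- Strict case: the midpoint of `V x` and `c x` separates the continuation term from the running
  -- minimum.
  · have hBcont : ∀ᶠ s in 𝓝[>] (0 : ℝ), B s ≤ (V x + c x) / 2 := by
      have h1 : Tendsto B (𝓝[>] 0) (𝓝 (V x)) := by
        have := hBd.continuousWithinAt.mono Ioi_subset_Ici_self
        change Tendsto B _ (𝓝 (B 0)) at this
        rwa [hB0] at this
      exact h1.eventually (ge_mem_nhds (by linarith))
    have hDlow : ∀ᶠ s in 𝓝[>] (0 : ℝ), (V x + c x) / 2 ≤ sInf (D '' Icc 0 s) :=
      eventually_le_sInf_image_Icc hDcont (by rw [hD0]; linarith)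
    have hlim : Tendsto (advantageQuotient X U f g c lam x u) (𝓝[>] 0)
        (𝓝 (lam * c x + (fderivWithin ℝ V X x (f x + g x u) - lam * V x))) := by
      refine hBq.congr' ?_
      filter_upwards [hBcont, hDlow] with s h1 h2
      rw [hquot, min_eq_right (h1.trans h2)]
    -- Nonpositivity of this limit makes it smaller than `c x - V x > 0`, so it is the claimed
    -- minimum.
    have hnonpos : lam * c x + (fderivWithin ℝ V X x (f x + g x u) - lam * V x) ≤ 0 := by
      refine le_of_tendsto hlim ?_
      filter_upwards [self_mem_nhdsWithin] with s hs using
        hwp.advantageQuotient_nonpos hfin hc.continuousOn hx hu (le_of_lt hs)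
    rw [min_eq_right (by linarith)]
    convert hlim using 2
    ring

theorem isClosed_inputSpace {k : ℕ} (A : Matrix (Fin k) (Fin m) ℝ) (b : Fin k → ℝ) :
    IsClosed (inputSpace A b) := by
  have : inputSpace A b = ⋂ i, {u | (A *ᵥ u.ofLp) i ≤ b i} := by
    ext u; simp [inputSpace]
  rw [this]
  refine isClosed_iInter fun i => isClosed_le ?_ continuous_const
  simp only [Matrix.mulVec, dotProduct]
  fun_prop

end

end SafetyAdvantage

theorem mainTheorem1 {n m k : ℕ}
    (X : Set (EuclideanSpace ℝ (Fin n))) (hX : UniqueDiffOn ℝ X)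
    (A : Matrix (Fin k) (Fin m) ℝ) (b : Fin k → ℝ)
    (U : Set (EuclideanSpace ℝ (Fin m))) (hU : U = SafetyAdvantage.inputSpace A b)
    (hUne : U.Nonempty) (hUbdd : Bornology.IsBounded U)
    (f : EuclideanSpace ℝ (Fin n) → EuclideanSpace ℝ (Fin n))
    (g : EuclideanSpace ℝ (Fin n) → (EuclideanSpace ℝ (Fin m) →L[ℝ] EuclideanSpace ℝ (Fin n)))
    (hf : ContinuousOn f X) (hg : ContinuousOn g X)
    (hwp : SafetyAdvantage.WellPosed X U f g)
    (c : EuclideanSpace ℝ (Fin n) → ℝ) (hc : DifferentiableOn ℝ c X)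
    (lam : ℝ) (hlam : 0 ≤ lam)
    (hVfin : ∀ x ∈ X, SafetyAdvantage.extValue X U f g c lam x ≠ ⊥)
    (hV : DifferentiableOn ℝ (SafetyAdvantage.value X U f g c lam) X) :
    (∀ x ∈ X, ∀ u ∈ U,
      Tendsto (SafetyAdvantage.advantageQuotient X U f g c lam x u) (𝓝[>] 0)
        (𝓝 (SafetyAdvantage.advantage X U f g c lam x u))) ∧
    (∀ x ∈ X, ∀ u ∈ U,
      SafetyAdvantage.advantage X U f g c lam x u =
        min (c x - SafetyAdvantage.value X U f g c lam x)
          (fderivWithin ℝ (SafetyAdvantage.value X U f g c lam) X x (f x + g x u) +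
            lam * (c x - SafetyAdvantage.value X U f g c lam x))) ∧
    (∀ x ∈ X, ∀ u ∈ U, SafetyAdvantage.advantage X U f g c lam x u ≤ 0) ∧
    (∀ x ∈ X, IsGreatest (SafetyAdvantage.advantage X U f g c lam x '' U) 0) := by
  have hlim : ∀ x ∈ X, ∀ u ∈ U, _ := fun x hx u hu =>
    hwp.tendsto_advantageQuotient hf hg hVfin hc hV hx hu
  have hadv : ∀ x ∈ X, ∀ u ∈ U, SafetyAdvantage.advantage X U f g c lam x u = _ :=
    fun x hx u hu => (hlim x hx u hu).limUnder_eq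
  have hnonpos : ∀ x ∈ X, ∀ u ∈ U, SafetyAdvantage.advantage X U f g c lam x u ≤ 0 := by
    intro x hx u hu
    rw [hadv x hx u hu]
    refine le_of_tendsto (hlim x hx u hu) ?_
    filter_upwards [self_mem_nhdsWithin] with s hs using
      hwp.advantageQuotient_nonpos hVfin hc.continuousOn hx hu (le_of_lt hs)
  refine ⟨fun x hx u hu => ?_, hadv, hnonpos, fun x hx => ⟨?_, ?_⟩⟩
  · rw [hadv x hx u hu]
    exact hlim x hx u hu
  · have hUc : IsCompact U := Metric.isCompact_of_isClosed_isBounded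
      (hU ▸ SafetyAdvantage.isClosed_inputSpace A b) hUbdd
    obtain ⟨u, hu, hmax⟩ := hUc.exists_isMaxOn hUne
      (f := fun u => fderivWithin ℝ (SafetyAdvantage.value X U f g c lam) X x (f x + g x u))
      (by fun_prop)
    refine ⟨u, hu, le_antisymm (hnonpos x hx u hu) ?_⟩
    -- Here `a` is the maximal derivative of `V`, attained at `u`; the bound says that the second
    -- term of the minimum is nonnegative there.
    have h1 := hwp.le_of_forall_fderivWithin_le hUbdd hf hg hVfin hc.continuousOn hlam hV hx
      (fun v hv => hmax hv)
    rw [hadv x hx u hu]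
    exact le_min (sub_nonneg.2 (hwp.value_le hx (hVfin x hx))) (by linarith)
  · rintro _ ⟨u, hu, rfl⟩
    exact hnonpos x hx u hu
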